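/- Let $G$ be a countable discrete group, let $X$ be a compact Hausdorff space, and let $\alpha: G\curvearrowright X$ be a free action by homeomorphisms. Write $M_n$ for the complex $n\times n$ matrices, $D_n\subseteq M_n$ for the diagonal matrices, and $C(X)\rtimes_\alpha G$ for the reduced crossed product; regard $D_n\otimes C(X)$ as a $C^*$-subalgebra of $M_n\otimes (C(X)\rtimes_\alpha G)$. For $C^*$-algebras $D\subseteq A$, an element $t\in A$ is an $r$-normalizer of $D$ in $A$ if $t^*Dt\subseteq D$. For $f\in C(X)$ put $\mathrm{supp}^\circ(f)=\{x\in X: f(x)\ne 0\}$, and for a positive element $c$ and $\delta>0$ let $(c-\delta)_+$ be given by functional calculus with $s\mapsto\max(s-\delta,0)$. For compact sets $F_1,\dots,F_n\subseteq X$ and open sets $V_1,\dots,V_m\subseteq X$ write $(F_1,\dots,F_n)\prec(V_1,\dots,V_m)$ if there are open sets $U_{i,j}\subseteq X$, elements $s_{i,j}\in G$ and indices $k_{i,j}\in\{1,\dots,m\}$, for $i=1,\dots,n$ and $j=1,\dots,J_i$, such that $F_i\subseteq U_{i,1}\cup\dots\cup U_{i,J_i}$ for each $i$ and the sets $s_{i,j}U_{i,j}\times\{k_{i,j}\}$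 (over all pairs $(i,j)$) are pairwise disjoint subsets of $\bigcup_{l=1}^m V_l\times\{l\}$. For positive $a=\mathrm{diag}(a_1,\dots,a_n)\in D_n\otimes C(X)$ and $b=\mathrm{diag}(b_1,\dots,b_m)\in D_m\otimes C(X)$ write $a\preccurlyeq b$ if $(F_1,\dots,F_n)\prec(\mathrm{supp}^\circ(b_1),\dots,\mathrm{supp}^\circ(b_m))$ for all compact sets $F_1,\dots,F_n$ with $F_i\subseteq\mathrm{supp}^\circ(a_i)$ for every $i$. Let $a,b\in D_n\otimes C(X)$ be positive. The following are equivalent: (i) $a\preccurlyeq b$; (ii) there is a sequence $(t_k)_{k=1}^\infty$ of $r$-normalizers of $D_n\otimes C(X)$ in $M_n\otimes(C(X)\rtimes_\alpha G)$ such that $\lim_{k\to\infty}\|t_k^*bt_k-a\|=0$; (iii) for every $\varepsilon>0$ there are $\delta>0$ and an $r$-normalizer $t$ of $D_n\otimes C(X)$ in $M_n\otimes(C(X)\rtimes_\alpha G)$ such that $t^*(b-\delta)_+t=(a-\varepsilon)_+$. -/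

import Mathlib

open scoped ComplexOrder ENNReal Topology

noncomputable section

namespace DynCuntz

/-! ### The reduced crossed product `C(X) ⋊ G` -/

/-- The Hilbert space `ℓ²(G, ℓ²(X)) = ℓ²(G × X)`, where `G` and `X` are regarded as discrete
sets. -/
abbrev RegSpace (G X : Type*) : Type _ := lp (fun _ : G × X => ℂ) 2

section Shift

variable {G X : Type*} [Group G]

theorem hasSum_shift (h : G) (ξ : RegSpace G X) :
    HasSum (fun p : G × X => ‖ξ (h⁻¹ * p.1, p.2)‖ ^ (2 : ℝ≥0∞).toReal)
      (‖ξ‖ ^ (2 : ℝ≥0∞).toReal) :=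
  (((Equiv.mulLeft h⁻¹).prodCongr (Equiv.refl X)).hasSum_iff).2 (lp.hasSum_norm (by simp) ξ)

variable (X) in
/-- The canonical unitary `u_h`, acting by left translation: `(u_h ξ)(g, x) = ξ(h⁻¹ g, x)`. -/
def shiftOp (h : G) : RegSpace G X →L[ℂ] RegSpace G X :=
  LinearMap.mkContinuous
    { toFun := fun ξ => ⟨fun p => ξ (h⁻¹ * p.1, p.2), memℓp_gen (hasSum_shift h ξ).summable⟩
      map_add' := fun _ _ => rfl
      map_smul' := fun _ _ => rfl }
    1 fun ξ => by
      rw [one_mul]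
      exact lp.norm_le_of_tsum_le (by simp) (norm_nonneg _) (hasSum_shift h ξ).tsum_eq.le

theorem shiftOp_apply (h : G) (ξ : RegSpace G X) (p : G × X) :
    shiftOp X h ξ p = ξ (h⁻¹ * p.1, p.2) := rfl

end Shift

section CrossedProduct

variable {G X : Type*} [Group G] [TopologicalSpace X] [CompactSpace X] [MulAction G X]

/-- Multiplication by the function `(g, x) ↦ f (g • x)` on `ℓ²(G × X)`. -/
def multOp (f : C(X, ℂ)) : RegSpace G X →L[ℂ] RegSpace G X :=
  lp.mapCLM 2 (fun p : G × X => ContinuousLinearMap.mul ℂ ℂ (f (p.1 • p.2))) (norm_nonneg f)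
    fun _ => (ContinuousLinearMap.opNorm_mul_apply_le ℂ ℂ _).trans (f.norm_coe_le_norm _)

theorem multOp_apply (f : C(X, ℂ)) (ξ : RegSpace G X) (p : G × X) :
    multOp f ξ p = f (p.1 • p.2) * ξ p := by
  simp [multOp]

theorem star_multOp (f : C(X, ℂ)) :
    multOp (G := G) (star f) = star (multOp (G := G) f) := by
  rw [ContinuousLinearMap.star_eq_adjoint, ContinuousLinearMap.eq_adjoint_iff]
  intro ξ η
  rw [lp.inner_eq_tsum, lp.inner_eq_tsum]
  refine tsum_congr fun p => ?_
  rw [multOp_apply, multOp_apply]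
  simp [RCLike.inner_apply]
  ring

variable (G X) in
/-- The regular representation of `C(X)` on `ℓ²(G, ℓ²(X))` induced by the faithful representation
of `C(X)` on `ℓ²(X)` by multiplication operators: `(f ξ)(g) = (f ∘ α_g) ξ(g)`, that is,
`(f ξ)(g, x) = f (g • x) ξ(g, x)`. -/
def regRep : C(X, ℂ) →⋆ₐ[ℂ] (RegSpace G X →L[ℂ] RegSpace G X) where
  toFun f := multOp f
  map_one' := by ext ξ p; simp [multOp_apply]
  map_mul' f g := by ext ξ p; simp [multOp_apply, mul_assoc]
  map_zero' := by ext ξ p; simp [multOp_apply]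
  map_add' f g := by ext ξ p; simp [multOp_apply, add_mul]
  commutes' c := by
    ext ξ p
    simp [multOp_apply, Algebra.algebraMap_eq_smul_one]
  map_star' f := star_multOp f

variable (G X) in
/-- The concrete C⋆-algebra on `ℓ²(G, ℓ²(X))` generated by the image of `C(X)` under the regular
representation and the canonical unitaries `u_g`, `g ∈ G`. -/
def crossedSubalgebra : StarSubalgebra ℂ (RegSpace G X →L[ℂ] RegSpace G X) :=
  (StarAlgebra.adjoin ℂ
    (Set.range (regRep G X) ∪ Set.range (shiftOp (G := G) X))).topologicalClosure

variable (G X) in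
/-- The reduced crossed product `C(X) ⋊ G` of a discrete group `G` acting on a compact
space `X`. -/
def CrossedProduct : Type _ := crossedSubalgebra G X

instance : IsClosed (crossedSubalgebra G X : Set (RegSpace G X →L[ℂ] RegSpace G X)) :=
  StarSubalgebra.isClosed_topologicalClosure _

instance : CStarAlgebra (CrossedProduct G X) :=
  inferInstanceAs (CStarAlgebra (crossedSubalgebra G X))

instance : PartialOrder (CrossedProduct G X) := CStarAlgebra.spectralOrder _

instance : StarOrderedRing (CrossedProduct G X) := CStarAlgebra.spectralOrderedRing _

variable (G X) in
/-- The canonical embedding of `C(X)` in `C(X) ⋊ G`. -/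
def incl : C(X, ℂ) →⋆ₐ[ℂ] CrossedProduct G X :=
  (regRep G X).codRestrict (crossedSubalgebra G X) fun f =>
    StarSubalgebra.le_topologicalClosure _ (StarAlgebra.subset_adjoin ℂ _ (Or.inl ⟨f, rfl⟩))

variable (G X) in
/-- The embedding of `D_n ⊗ C(X) = C(X)ⁿ` in the C⋆-algebra `M_n ⊗ (C(X) ⋊ G)` which takes
`(f_1, …, f_n)` to `diag (f_1, …, f_n)`. -/
def diag (n : ℕ) : (Fin n → C(X, ℂ)) →⋆ₐ[ℂ] CStarMatrix (Fin n) (Fin n) (CrossedProduct G X) where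
  toFun f := CStarMatrix.ofMatrix (Matrix.diagonal fun i => incl G X (f i))
  map_one' := by
    simp only [Pi.one_apply, map_one, Matrix.diagonal_one]
    rfl
  map_mul' f g := by
    simp only [Pi.mul_apply, map_mul]
    exact congrArg CStarMatrix.ofMatrix (Matrix.diagonal_mul_diagonal _ _).symm
  map_zero' := by
    simp only [Pi.zero_apply, map_zero, Matrix.diagonal_zero]
    rfl
  map_add' f g := by
    simp only [Pi.add_apply, map_add]
    exact congrArg CStarMatrix.ofMatrix (Matrix.diagonal_add _ _).symm
  commutes' c := by
    ext i j
    rw [CStarMatrix.algebraMap_apply]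
    simp [Matrix.diagonal_apply, Pi.algebraMap_apply, AlgHomClass.commutes]
  map_star' f := by
    simp only [Pi.star_apply, map_star]
    exact congrArg CStarMatrix.ofMatrix (Matrix.diagonal_conjTranspose _).symm

variable (G X) in
/-- The C⋆-subalgebra `D_n ⊗ C(X)` of `M_n ⊗ (C(X) ⋊ G)`. -/
def diagSubalgebra (n : ℕ) :
    StarSubalgebra ℂ (CStarMatrix (Fin n) (Fin n) (CrossedProduct G X)) :=
  (diag G X n).range

end CrossedProduct

/-! ### One-sided normalizers and cut-downs -/

/-- `t` is an `r`-normalizer of the C⋆-subalgebra `D` of `A`: `t⋆ D t ⊆ D`. -/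
def IsRNormalizer {A : Type*} [CStarAlgebra A] (D : StarSubalgebra ℂ A) (t : A) : Prop :=
  ∀ d ∈ D, star t * d * t ∈ D

/-- `(c - δ)₊`, defined by continuous functional calculus. -/
def cutDown {A : Type*} [CStarAlgebra A] (c : A) (δ : ℝ) : A :=
  cfc (fun s : ℝ => max (s - δ) 0) c

/-! ### Dynamical subequivalence -/

section Dynamical

variable (G : Type*) {X : Type*} [Group G] [TopologicalSpace X] [MulAction G X]

/-- The relation `(F_1, …, F_n) ≺ (V_1, …, V_m)`: there are finitely many open sets `U i j`
such that `F_i ⊆ ⋃ j, U i j` for each `i`, together with group elements `s i j` and indices `k i j`,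
such that the sets `(s i j) U i j × {k i j}` (over all pairs `i, j`) are pairwise disjoint subsets
of the disjoint union of the `V_l × {l}`. -/
def SetsSubequiv {n m : ℕ} (F : Fin n → Set X) (V : Fin m → Set X) : Prop :=
  ∃ (J : Fin n → ℕ) (U : (i : Fin n) → Fin (J i) → Set X) (s : (i : Fin n) → Fin (J i) → G)
    (k : (i : Fin n) → Fin (J i) → Fin m),
    (∀ i j, IsOpen (U i j)) ∧
    (∀ i, F i ⊆ ⋃ j, U i j) ∧
    (Pairwise fun p q : (Σ i, Fin (J i)) =>
      Disjoint (((fun x => s p.1 p.2 • x) '' U p.1 p.2) ×ˢ {k p.1 p.2})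
        (((fun x => s q.1 q.2 • x) '' U q.1 q.2) ×ˢ {k q.1 q.2})) ∧
    ∀ i j, ((fun x => s i j • x) '' U i j) ×ˢ {k i j} ⊆ ⋃ l, V l ×ˢ {l}

/-- The dynamical subequivalence `diag (a_1, …, a_n) ≼ diag (b_1, …, b_m)`. -/
def DynSubequiv {n m : ℕ} (a : Fin n → C(X, ℂ)) (b : Fin m → C(X, ℂ)) : Prop :=
  ∀ F : Fin n → Set X, (∀ i, IsCompact (F i)) → (∀ i, F i ⊆ Function.support (a i)) →
    SetsSubequiv G F fun l => Function.support (b l)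

end Dynamical

end DynCuntz

end

/-!
The equivalence rests on the description of `C(X) ⋊ G` by functions on the transformation groupoid.

An element `T` of `C(X) ⋊ G` acts on `ℓ²(G × X)`, and its matrix entry from `(h, x)` to `(g h, x)`
is a continuous function `φ_g` of the point `h • x`, the coefficient of `T` at `g`, while entries
between different points of `X` vanish (`crossedSubalgebra_subset_groupoidOperators`). The action
being free, the points `g • x`, `g ∈ G`, are distinct, and functions in `C(X)` separate them even
in `ℓ¹`-combinations (`eq_zero_of_forall_tsum_mul_eq_zero`). If `t` is an `r`-normalizer, then
`t⋆ d t` has no off-diagonal entries for any diagonal `d`, and letting `d` concentrate at a single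
point shows that every row of the matrix of `t` on `⨁ ℓ²(G × X)` has at most one nonzero entry
(`IsRNormalizer.apply_eq_zero_or`). So the open supports of the coefficients of the entries of
`t`, translated by the respective group elements, are pairwise disjoint. If `t⋆ b t` is close to
`a`, then those parts of these supports which are mapped into the support of `b` cover a given
compact subset of the support of `a`; hence `a ≼ b` (`dynSubequiv_of_tendsto`).

Conversely, let `a ≼ b`. For the compact sets `{a_i ≥ ε}`, a partition of unity subordinate to the
sets `U i j` gives functions `γ i j` supported in `U i j`, and the matrix with the entries
`∑ u_s γ i j` is an `r`-normalizer, since the disjointness of the translates removes all mixed terms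
(`star_translationMatrix_mul_diag_mul`). By compactness `b` is bounded below on the translated
supports, so `γ i j` can be normalized such that `t⋆ (b - δ)₊ t = (a - ε)₊`
(`exists_cutDown_of_dynSubequiv`). Finally `(b - δ)₊ = c b c` for a diagonal `c`, so that `c t`
conjugates `b` to `(a - ε)₊`, which is within `ε` of `a` (`exists_tendsto_of_forall_cutDown`).
-/

noncomputable section

namespace DynCuntz

/-! ### Matrix entries of elements of the crossed product -/

section Operators

variable {G X : Type*}

open scoped Classical in
/-- The orthonormal basis vector of `ℓ²(G × X)` at the point `q`. -/
def basisVec (q : G × X) : RegSpace G X := lp.single 2 q 1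

@[simp]
theorem norm_basisVec (q : G × X) : ‖basisVec q‖ = 1 := by
  classical
  simp [basisVec, lp.norm_single]

theorem norm_apply_basisVec_le (T : RegSpace G X →L[ℂ] RegSpace G X) (p q : G × X) :
    ‖T (basisVec q) p‖ ≤ ‖T‖ :=
  (lp.norm_apply_le_norm (by simp) _ p).trans <| by simpa using T.le_opNorm (basisVec q)

theorem continuous_apply_basisVec (p q : G × X) :
    Continuous fun T : RegSpace G X →L[ℂ] RegSpace G X => T (basisVec q) p :=
  (continuous_apply p).comp <| (lp.uniformContinuous_coe (E := fun _ : G × X => ℂ)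
    (p := 2)).continuous.comp (ContinuousLinearMap.apply ℂ _ (basisVec q)).continuous

variable [Group G]

theorem star_shiftOp (h : G) : star (shiftOp X h) = shiftOp X h⁻¹ := by
  symm
  rw [ContinuousLinearMap.star_eq_adjoint, ContinuousLinearMap.eq_adjoint_iff]
  intro ξ η
  rw [lp.inner_eq_tsum, lp.inner_eq_tsum,
    ← ((Equiv.mulLeft h).prodCongr (Equiv.refl X)).tsum_eq
      (fun p => inner ℂ (ξ p) (shiftOp X h η p))]
  refine tsum_congr fun p => ?_
  simp [shiftOp_apply, Prod.map]

variable (G X) in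
/-- The operators on `ℓ²(G × X)` whose matrix `(T (δ (h, x))) (g, x')` is given by a function on
the transformation groupoid: it vanishes unless `x' = x`, its entry from `(h, x)` to `(g * h, x)`
depends only on `g` and the point `h • x`, and it depends continuously on that point. -/
def groupoidOperators [TopologicalSpace X] [MulAction G X] :
    Submodule ℂ (RegSpace G X →L[ℂ] RegSpace G X) where
  carrier := {T | (∀ g h x x', x' ≠ x → T (basisVec (h, x)) (g, x') = 0) ∧
    (∀ g h x, T (basisVec (h, x)) (g * h, x) = T (basisVec (1, h • x)) (g, h • x)) ∧
    ∀ g, Continuous fun x => T (basisVec (1, x)) (g, x)}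
  add_mem' := by
    rintro S T ⟨hS₁, hS₂, hS₃⟩ ⟨hT₁, hT₂, hT₃⟩
    refine ⟨fun g h x x' hx => ?_, fun g h x => ?_, fun g => (hS₃ g).add (hT₃ g)⟩
    · simp [hS₁ g h x x' hx, hT₁ g h x x' hx]
    · simp [hS₂ g h x, hT₂ g h x]
  zero_mem' := by
    refine ⟨fun _ _ _ _ _ => rfl, fun _ _ _ => rfl, fun _ => continuous_const⟩
  smul_mem' := by
    rintro c T ⟨hT₁, hT₂, hT₃⟩
    refine ⟨fun g h x x' hx => ?_, fun g h x => ?_, fun g => (hT₃ g).const_smul c⟩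
    · simp [hT₁ g h x x' hx]
    · simp [hT₂ g h x]

variable [TopologicalSpace X]

theorem isClosed_groupoidOperators [MulAction G X] :
    IsClosed (groupoidOperators G X : Set (RegSpace G X →L[ℂ] RegSpace G X)) := by
  refine isClosed_of_closure_subset fun T hT =>
    ⟨fun g h x x' hx => ?_, fun g h x => ?_, fun g => ?_⟩
  · exact closure_minimal (fun S hS => hS.1 g h x x' hx)
      (isClosed_eq (continuous_apply_basisVec _ _) continuous_const) hT
  · exact closure_minimal (fun S hS => hS.2.1 g h x)
      (isClosed_eq (continuous_apply_basisVec _ _) (continuous_apply_basisVec _ _)) hT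
  · refine continuous_of_uniform_approx_of_continuous fun u hu => ?_
    obtain ⟨ε, hε, hu⟩ := Metric.mem_uniformity_dist.1 hu
    obtain ⟨S, hS, hST⟩ := Metric.mem_closure_iff.1 hT ε hε
    refine ⟨_, hS.2.2 g, fun x => hu ?_⟩
    refine lt_of_le_of_lt ?_ hST
    rw [dist_eq_norm, dist_eq_norm]
    exact norm_apply_basisVec_le (T - S) _ _

theorem one_mem_groupoidOperators [MulAction G X] :
    (1 : RegSpace G X →L[ℂ] RegSpace G X) ∈ groupoidOperators G X := by
  classical
  refine ⟨fun g h x x' hx => ?_, fun g h x => ?_, fun g => ?_⟩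
  · simp [basisVec, lp.single_apply, hx]
  · simp [basisVec, lp.single_apply, Pi.single_apply]
  · simp [basisVec, lp.single_apply, Pi.single_apply, continuous_const]

theorem shiftOp_mul_mem_groupoidOperators [MulAction G X] (s : G)
    {T : RegSpace G X →L[ℂ] RegSpace G X} (hT : T ∈ groupoidOperators G X) :
    shiftOp X s * T ∈ groupoidOperators G X := by
  obtain ⟨hT₁, hT₂, hT₃⟩ := hT
  refine ⟨fun g h x x' hx => ?_, fun g h x => ?_, fun g => ?_⟩
  · simpa [shiftOp_apply] using hT₁ _ h x x' hx
  · simpa [shiftOp_apply, mul_assoc] using hT₂ (s⁻¹ * g) h x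
  · simpa [shiftOp_apply] using hT₃ (s⁻¹ * g)

variable [CompactSpace X] [MulAction G X] [ContinuousConstSMul G X]

theorem multOp_mul_mem_groupoidOperators (f : C(X, ℂ))
    {T : RegSpace G X →L[ℂ] RegSpace G X} (hT : T ∈ groupoidOperators G X) :
    multOp f * T ∈ groupoidOperators G X := by
  obtain ⟨hT₁, hT₂, hT₃⟩ := hT
  refine ⟨fun g h x x' hx => ?_, fun g h x => ?_, fun g => ?_⟩
  · simp [multOp_apply, hT₁ _ h x x' hx]
  · simp [multOp_apply, hT₂, mul_smul]
  · simp only [mul_apply_eq_comp, multOp_apply]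
    exact (f.continuous.comp (continuous_const_smul g)).mul (hT₃ g)

/-- Operators in `C(X) ⋊ G` have continuous coefficients: stability of `groupoidOperators` under
left multiplication by the generators suffices, since it is a closed subspace containing `1`. -/
theorem crossedSubalgebra_subset_groupoidOperators :
    (crossedSubalgebra G X : Set (RegSpace G X →L[ℂ] RegSpace G X)) ⊆ groupoidOperators G X := by
  have hgen : ∀ S ∈ Set.range (regRep G X) ∪ Set.range (shiftOp (G := G) X),
      ∀ T ∈ groupoidOperators G X, S * T ∈ groupoidOperators G X := by
    rintro _ (⟨f, rfl⟩ | ⟨s, rfl⟩) T hT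
    · exact multOp_mul_mem_groupoidOperators f hT
    · exact shiftOp_mul_mem_groupoidOperators s hT
  have hstar : star (Set.range (regRep G X) ∪ Set.range (shiftOp (G := G) X)) ⊆
      Set.range (regRep G X) ∪ Set.range (shiftOp (G := G) X) := by
    rintro S (⟨f, hf⟩ | ⟨s, hs⟩)
    · exact Or.inl ⟨star f, by rw [map_star, hf, star_star]⟩
    · exact Or.inr ⟨s⁻¹, by rw [← star_shiftOp, hs, star_star]⟩
  have hadj : Subalgebra.toSubmodule (StarAlgebra.adjoin ℂ
      (Set.range (regRep G X) ∪ Set.range (shiftOp (G := G) X))).toSubalgebra ≤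
      groupoidOperators G X := by
    rw [StarAlgebra.adjoin_eq_span, Submodule.span_le, Set.union_eq_self_of_subset_right hstar]
    intro T hT
    induction hT using Submonoid.closure_induction_left with
    | one => exact one_mem_groupoidOperators
    | mul_left S hS T _ ih => exact hgen S hS T ih
  exact closure_minimal hadj isClosed_groupoidOperators

end Operators

/-! ### Separation of points by continuous functions -/

/-- Point evaluations at distinct points of a normal space are separated by continuous functions
even in infinite absolutely convergent combinations. -/
theorem eq_zero_of_forall_tsum_mul_eq_zero {ι X : Type*} [TopologicalSpace X] [NormalSpace X]
    [T1Space X] {y : ι → X} (hy : Function.Injective y) {c : ι → ℂ} (hc : Summable c)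
    (h : ∀ d : C(X, ℂ), ∑' i, c i * d (y i) = 0) (i : ι) : c i = 0 := by
  classical
  -- Functions `d s` equal to `1` at `y i` and to `0` at the other points `y j`, `j ∈ s`.
  have key : ∀ s : Finset ι, ∃ d : C(X, ℂ),
      d (y i) = 1 ∧ (∀ j ∈ s, j ≠ i → d (y j) = 0) ∧ ∀ x, ‖d x‖ ≤ 1 := by
    intro s
    have hdis : Disjoint (y '' (s.erase i : Set ι)) {y i} := by
      rw [Set.disjoint_singleton_right]
      rintro ⟨j, hj, hji⟩
      exact (Finset.mem_erase.1 hj).1 (hy hji)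
    obtain ⟨f, hf₀, hf₁, hf⟩ := exists_continuous_zero_one_of_isClosed
      ((s.erase i).finite_toSet.image y).isClosed isClosed_singleton hdis
    refine ⟨⟨fun x => (f x : ℂ), by fun_prop⟩, ?_, fun j hj hji => ?_, fun x => ?_⟩
    · simp [hf₁ (Set.mem_singleton (y i))]
    · simp [hf₀ (Set.mem_image_of_mem y (Finset.mem_coe.2 (Finset.mem_erase.2 ⟨hji, hj⟩)))]
    · simpa [abs_of_nonneg (hf x).1] using (hf x).2
  choose d hd₁ hd₀ hd using key
  have hlim : Filter.Tendsto (fun s : Finset ι => ∑' j, c j * d s (y j)) Filter.atTop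
      (𝓝 (∑' j, if j = i then c i else 0)) := by
    refine tendsto_tsum_of_dominated_convergence hc.norm (fun j => ?_) (.of_forall fun s j => ?_)
    · refine tendsto_const_nhds.congr' ?_
      filter_upwards [Filter.eventually_ge_atTop {j}] with s hs
      split_ifs with hji
      · rw [hji, hd₁, mul_one]
      · rw [hd₀ s j (hs (Finset.mem_singleton_self j)) hji, mul_zero]
    · rw [norm_mul]
      exact mul_le_of_le_one_right (norm_nonneg _) (hd s _)
  simp only [h, tsum_ite_eq] at hlim
  exact tendsto_nhds_unique hlim tendsto_const_nhds

theorem inner_basisVec_left {G X : Type*} (p : G × X) (ξ : RegSpace G X) :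
    inner ℂ (basisVec p) ξ = ξ p := by
  classical
  have := lp.inner_single_left (𝕜 := ℂ) (G := fun _ : G × X => ℂ) p 1 ξ
  simp only [basisVec]
  convert this using 1
  simp

/-! ### Matrix entries of normalizers -/

section CrossedProduct

variable {G X : Type*} [Group G] [TopologicalSpace X] [CompactSpace X] [MulAction G X]

/-- If the vectors `P (δ a)` and `d (Q (δ b))` are orthogonal for every `d ∈ C(X)`, where the
basis vectors `δ a` and `δ b` belong to the same orbit, then `P (δ a)` and `Q (δ b)` have disjoint
supports. The point `x` has trivial stabilizer, so that functions on `X` separate `G • x`. -/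
theorem apply_eq_zero_or_of_inner_multOp_eq_zero [T2Space X] {x : X}
    (hx : ∀ g : G, g • x = x → g = 1)
    {P Q : RegSpace G X →L[ℂ] RegSpace G X} (hP : P ∈ groupoidOperators G X) {h h' : G}
    (hPQ : ∀ d : C(X, ℂ),
      inner ℂ (P (basisVec (h, x))) (multOp d (Q (basisVec (h', x)))) = 0) (g : G) :
    P (basisVec (h, x)) (g, x) = 0 ∨ Q (basisVec (h', x)) (g, x) = 0 := by
  have hinj : Function.Injective fun g : G => (g, x) := fun _ _ h => (Prod.ext_iff.1 h).1
  have hy : Function.Injective fun g : G => g • x := by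
    intro g₁ g₂ h
    have := hx (g₁⁻¹ * g₂) (by rw [mul_smul, ← show g₁ • x = g₂ • x from h, inv_smul_smul])
    exact inv_mul_eq_one.1 this
  have hc : Summable fun g : G =>
      inner ℂ (P (basisVec (h, x)) (g, x)) (Q (basisVec (h', x)) (g, x)) :=
    (lp.summable_inner (𝕜 := ℂ) (P (basisVec (h, x))) (Q (basisVec (h', x)))).comp_injective hinj
  have := eq_zero_of_forall_tsum_mul_eq_zero hy hc (fun d => ?_) g
  · simpa [or_comm] using this
  · rw [← hPQ d, lp.inner_eq_tsum, ← hinj.tsum_eq]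
    · refine tsum_congr fun g => ?_
      rw [multOp_apply]
      simp only [RCLike.inner_apply]
      ring
    · rintro ⟨g', x'⟩ hp
      by_contra hx'
      refine hp ?_
      simp only
      rw [hP.1 g' h x x' fun hxx => hx' ⟨g', by rw [hxx]⟩, inner_zero_left]

variable (G X) in
/-- The defining representation of `C(X) ⋊ G` on `ℓ²(G × X)`. -/
def toOp : CrossedProduct G X →⋆ₐ[ℂ] (RegSpace G X →L[ℂ] RegSpace G X) :=
  (crossedSubalgebra G X).subtype

theorem toOp_injective : Function.Injective (toOp G X) := Subtype.val_injective

theorem norm_toOp (T : CrossedProduct G X) : ‖toOp G X T‖ = ‖T‖ := rfl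

@[simp]
theorem toOp_incl (f : C(X, ℂ)) : toOp G X (incl G X f) = multOp f := rfl

theorem toOp_mem_groupoidOperators [ContinuousConstSMul G X] (T : CrossedProduct G X) :
    toOp G X T ∈ groupoidOperators G X :=
  crossedSubalgebra_subset_groupoidOperators T.2

theorem toOp_star_mul_mul (P Q : CrossedProduct G X) (d : C(X, ℂ)) (p q : G × X) :
    toOp G X (star P * incl G X d * Q) (basisVec q) p =
      inner ℂ (toOp G X P (basisVec p)) (multOp d (toOp G X Q (basisVec q))) := by
  rw [← inner_basisVec_left, map_mul, map_mul, map_star, toOp_incl,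
    ContinuousLinearMap.star_eq_adjoint, mul_assoc, mul_apply_eq_comp,
    ContinuousLinearMap.adjoint_inner_right, mul_apply_eq_comp]

theorem diag_apply {n : ℕ} (f : Fin n → C(X, ℂ)) (i j : Fin n) :
    diag G X n f i j = if i = j then incl G X (f i) else 0 :=
  Matrix.diagonal_apply _ i j

theorem star_mul_diag_mul_apply {n : ℕ} (t : CStarMatrix (Fin n) (Fin n) (CrossedProduct G X))
    (d : Fin n → C(X, ℂ)) (i j : Fin n) :
    (star t * diag G X n d * t) i j = ∑ k, star (t k i) * incl G X (d k) * t k j := by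
  simp [CStarMatrix.mul_apply, CStarMatrix.star_apply, diag_apply]

/-- In each row `k` of an `r`-normalizer, the matrix of `t` on `⨁ ℓ²(G × X)` has at most one
nonzero entry. -/
theorem IsRNormalizer.apply_eq_zero_or [T2Space X] [ContinuousConstSMul G X]
    (hfree : ∀ (g : G) (x : X), g • x = x → g = 1) {n : ℕ}
    {t : CStarMatrix (Fin n) (Fin n) (CrossedProduct G X)}
    (ht : IsRNormalizer (diagSubalgebra G X n) t) (k : Fin n) {i i' : Fin n} {h h' : G}
    (hne : (i, h) ≠ (i', h')) (g : G) (x : X) :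
    toOp G X (t k i) (basisVec (h, x)) (g, x) = 0 ∨
      toOp G X (t k i') (basisVec (h', x)) (g, x) = 0 := by
  classical
  refine apply_eq_zero_or_of_inner_multOp_eq_zero (fun g => hfree g x)
    (toOp_mem_groupoidOperators _) (fun d => ?_) g
  obtain ⟨f, hf⟩ := ht (diag G X n (Pi.single k d)) ⟨_, rfl⟩
  have hf' : diag G X n f i i' = star (t k i) * incl G X d * t k i' := by
    rw [show diag G X n f = _ from hf, star_mul_diag_mul_apply, Finset.sum_eq_single k]
    · simp
    · intro l _ hl
      simp [Pi.single_eq_of_ne hl]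
    · simp
  rw [← toOp_star_mul_mul, ← hf', diag_apply]
  split_ifs with hi
  · have hh : h ≠ h' := fun hh => hne (by rw [hi, hh])
    simp [multOp_apply, basisVec, hh]
  · simp

end CrossedProduct

/-! ### From approximate conjugation to dynamical subequivalence -/

section Dynamical

variable {G X : Type*} [Group G] [TopologicalSpace X] [MulAction G X]

/-- For compact sets the finiteness of the families in `SetsSubequiv` is automatic. -/
theorem setsSubequiv_of_isCompact {n m : ℕ} {ι : Type*} {F : Fin n → Set X} {V : Fin m → Set X}
    (hF : ∀ i, IsCompact (F i)) (U : Fin n → ι → Set X) (s : ι → G) (k : ι → Fin m)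
    (hU : ∀ i c, IsOpen (U i c)) (hcov : ∀ i, F i ⊆ ⋃ c, U i c)
    (hdisj : ∀ i c i' c', k c = k c' → ∀ x ∈ U i c, ∀ x' ∈ U i' c',
      s c • x = s c' • x' → i = i' ∧ c = c')
    (hV : ∀ i c, ∀ x ∈ U i c, s c • x ∈ V (k c)) : SetsSubequiv G F V := by
  choose S hS using fun i => (hF i).elim_finite_subcover (U i) (hU i) (hcov i)
  let e : ∀ i, Fin (S i).card → ι := fun i j => ((S i).equivFin.symm j : ι)
  refine ⟨fun i => (S i).card, fun i j => U i (e i j), fun i j => s (e i j),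
    fun i j => k (e i j), fun i j => hU i _, fun i x hx => ?_, ?_, fun i j => ?_⟩
  · obtain ⟨c, hc, hxc⟩ := Set.mem_iUnion₂.1 (hS i hx)
    exact Set.mem_iUnion.2 ⟨(S i).equivFin ⟨c, hc⟩, by simpa [e] using hxc⟩
  · rintro ⟨i, j⟩ ⟨i', j'⟩ hne
    rw [Set.disjoint_left]
    rintro ⟨y, l⟩ ⟨⟨x, hx, hxy⟩, hl⟩ ⟨⟨x', hx', hxy'⟩, hl'⟩
    obtain ⟨rfl, hc⟩ := hdisj i (e i j) i' (e i' j') (hl.symm.trans hl') x hx x' hx'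
      (hxy.trans hxy'.symm)
    exact hne (by rw [(S i).equivFin.symm.injective (Subtype.ext hc)])
  · rintro ⟨y, l⟩ ⟨⟨x, hx, hxy⟩, hl⟩
    obtain rfl : l = _ := hl
    subst hxy
    exact Set.mem_iUnion.2 ⟨_, hV i _ x hx, rfl⟩

theorem exists_pos_forall_lt_of_isCompact {K : Set X} (hK : IsCompact K) {f : X → ℝ}
    (hf : ContinuousOn f K) (hpos : ∀ x ∈ K, 0 < f x) : ∃ ε > 0, ∀ x ∈ K, ε < f x := by
  obtain ⟨c, hc, h⟩ := hK.exists_forall_le' hf hpos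
  exact ⟨c / 2, half_pos hc, fun x hx => (half_lt_self hc).trans_le (h x hx)⟩

variable [CompactSpace X]

/-- The open sets witnessing `a ≼ b` are the supports of the coefficients of a single `r`-normalizer
`t` with `t⋆ b t` close to `a`, cut down to the points that are mapped into the support of `b`. -/
theorem dynSubequiv_of_tendsto [T2Space X] [ContinuousConstSMul G X]
    (hfree : ∀ (g : G) (x : X), g • x = x → g = 1) {n : ℕ} {a b : Fin n → C(X, ℂ)}
    {t : ℕ → CStarMatrix (Fin n) (Fin n) (CrossedProduct G X)}
    (ht : ∀ k, IsRNormalizer (diagSubalgebra G X n) (t k))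
    (hlim : Filter.Tendsto (fun k => ‖star (t k) * diag G X n b * t k - diag G X n a‖)
      Filter.atTop (𝓝 0)) :
    DynSubequiv G a b := by
  intro F hF hFa
  have hε : ∀ i, ∀ᶠ k in Filter.atTop, ∀ x ∈ F i,
      ‖star (t k) * diag G X n b * t k - diag G X n a‖ < ‖a i x‖ := by
    intro i
    obtain ⟨ε, hε, h⟩ := exists_pos_forall_lt_of_isCompact (hF i)
      (a i).continuous.norm.continuousOn fun x hx => norm_pos_iff.2 (hFa i hx)
    filter_upwards [hlim.eventually_lt_const hε] with k hk x hx using hk.trans (h x hx)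
  obtain ⟨k₀, hk₀⟩ := (Filter.eventually_all.2 hε).exists
  have ht := ht k₀
  generalize t k₀ = t at hk₀ ht
  have hT := fun k i => toOp_mem_groupoidOperators (t k i)
  -- The part of the support of `t` which starts in the `i`-th copy of `X`, has translation
  -- component `c.1` and ends in the `c.2`-th copy of `X`, inside the support of `b`.
  refine setsSubequiv_of_isCompact (ι := G × Fin n) hF
    (fun i c => {x | toOp G X (t c.2 i) (basisVec (1, x)) (c.1, x) ≠ 0 ∧ b c.2 (c.1 • x) ≠ 0})
    Prod.fst Prod.snd (fun i c => ?_) (fun i x hx => ?_) ?_ fun i c x hx => hx.2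
  · exact (isOpen_ne_fun ((hT c.2 i).2.2 c.1) continuous_const).inter
      (isOpen_ne_fun ((b c.2).continuous.comp (continuous_const_smul c.1)) continuous_const)
  · -- Otherwise the diagonal entry of `t⋆ b t` at `x` would vanish.
    by_contra hx'
    have hx' : ∀ g k, toOp G X (t k i) (basisVec (1, x)) (g, x) ≠ 0 → b k (g • x) = 0 := by
      simpa using hx'
    have hzero : toOp G X ((star t * diag G X n b * t) i i) (basisVec (1, x)) (1, x) = 0 := by
      rw [star_mul_diag_mul_apply, map_sum]
      simp only [sum_apply, lp.coeFn_sum, Finset.sum_apply]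
      refine Finset.sum_eq_zero fun k _ => ?_
      have : multOp (b k) (toOp G X (t k i) (basisVec (1, x))) = 0 := by
        ext ⟨g, x'⟩
        rw [multOp_apply]
        by_cases hxx : x' = x
        · subst hxx
          by_cases h0 : toOp G X (t k i) (basisVec (1, x')) (g, x') = 0
          · simp [h0]
          · simp [hx' g k h0]
        · simp [(hT k i).1 g 1 x x' hxx]
      rw [toOp_star_mul_mul, this, inner_zero_right]
    refine absurd (hk₀ i x hx) (not_lt.2 ?_)
    calc ‖a i x‖ = ‖toOp G X ((star t * diag G X n b * t - diag G X n a) i i)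
          (basisVec (1, x)) (1, x)‖ := by
          rw [CStarMatrix.sub_apply, map_sub, sub_apply, lp.coeFn_sub,
            Pi.sub_apply, hzero, diag_apply, if_pos rfl, toOp_incl, multOp_apply]
          simp [basisVec]
      _ ≤ ‖toOp G X ((star t * diag G X n b * t - diag G X n a) i i)‖ :=
          norm_apply_basisVec_le _ _ _
      _ ≤ _ := (norm_toOp _).trans_le CStarMatrix.norm_entry_le_norm
  · rintro i ⟨g, k⟩ i' ⟨g', k'⟩ hk x ⟨hx, -⟩ x' ⟨hx', -⟩ hgx
    obtain rfl : k = k' := hk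
    have hx'eq : x' = (g'⁻¹ * g) • x := by
      rw [mul_smul, show g • x = g' • x' from hgx, inv_smul_smul]
    subst hx'eq
    rw [← (hT k i').2.1, mul_inv_cancel_left] at hx'
    by_contra hne
    refine (ht.apply_eq_zero_or hfree k (i := i) (i' := i') (h := 1) (h' := g'⁻¹ * g)
      (fun h => hne ?_) g x).elim hx hx'
    obtain ⟨rfl, h⟩ := Prod.ext_iff.1 h
    exact ⟨rfl, by rw [inv_mul_eq_one.1 h.symm]⟩

end Dynamical

/-! ### Cut-downs of diagonal matrices -/

section CutDown

open scoped CStarAlgebra in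
theorem map_cutDown {A B : Type*} [CStarAlgebra A] [CStarAlgebra B] (φ : A →⋆ₐ[ℂ] B) {a : A}
    (ha : IsSelfAdjoint a) (δ : ℝ) : φ (cutDown a δ) = cutDown (φ a) δ :=
  φ.map_cfc _ a (by fun_prop) (map_continuous φ) ha (ha.map φ)

variable {X : Type*} [TopologicalSpace X]

/-- The function `x ↦ max (re (f x) - δ) 0`, which is `(f - δ)₊` for positive `f`. -/
def cutFun (f : C(X, ℂ)) (δ : ℝ) : C(X, ℂ) :=
  ⟨fun x => (max ((f x).re - δ) 0 : ℝ), by fun_prop⟩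

theorem cutFun_apply (f : C(X, ℂ)) (δ : ℝ) (x : X) :
    cutFun f δ x = (max ((f x).re - δ) 0 : ℝ) := rfl

theorem ofReal_re_of_nonneg {f : C(X, ℂ)} (hf : 0 ≤ f) (x : X) : ((f x).re : ℂ) = f x :=
  (Complex.eq_re_of_ofReal_le (r := 0) (by simpa using hf x)).symm

theorem re_nonneg_of_nonneg {f : C(X, ℂ)} (hf : 0 ≤ f) (x : X) : 0 ≤ (f x).re :=
  (Complex.le_def.1 (hf x)).1

theorem norm_cutFun_sub_le [CompactSpace X] {f : C(X, ℂ)} (hf : 0 ≤ f) {δ : ℝ} (hδ : 0 ≤ δ) :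
    ‖cutFun f δ - f‖ ≤ δ := by
  refine (ContinuousMap.norm_le _ hδ).2 fun x => ?_
  have h := re_nonneg_of_nonneg hf x
  rw [ContinuousMap.sub_apply, cutFun_apply, ← ofReal_re_of_nonneg hf x, ← Complex.ofReal_sub,
    Complex.norm_real, Real.norm_eq_abs, Complex.ofReal_re, abs_le]
  constructor
  · linarith [le_max_left ((f x).re - δ) 0]
  · linarith [max_le (show (f x).re - δ ≤ (f x).re by linarith) h]

variable {G : Type*} [Group G] [CompactSpace X] [MulAction G X]

theorem cutDown_diag {n : ℕ} {f : Fin n → C(X, ℂ)} (hf : ∀ i, 0 ≤ f i) (δ : ℝ) :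
    cutDown (diag G X n f) δ = diag G X n fun i => cutFun (f i) δ := by
  have hsa : IsSelfAdjoint f := funext fun i => by
    ext x
    rw [Pi.star_apply, ContinuousMap.star_apply, ← ofReal_re_of_nonneg (hf i) x]
    exact Complex.conj_ofReal _
  rw [← map_cutDown (diag G X n) hsa]
  congr 1
  ext i x
  let ev : (Fin n → C(X, ℂ)) →⋆ₐ[ℂ] ℂ :=
    (ContinuousMap.evalStarAlgHom ℂ ℂ x).comp (Pi.evalStarAlgHom ℂ (fun _ => C(X, ℂ)) i)
  have hev : ev f = algebraMap ℝ ℂ (f i x).re := (ofReal_re_of_nonneg (hf i) x).symm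
  change ev _ = _
  rw [map_cutDown ev hsa, hev, cutDown, cfc_algebraMap]
  rfl

/-- A diagonal matrix takes the factor `(b - δ)₊ = c b c` of `t⋆ (b - δ)₊ t` to `b`. -/
theorem exists_isRNormalizer_star_mul_diag_mul {n : ℕ} {b : Fin n → C(X, ℂ)}
    (hb : ∀ i, 0 ≤ b i) {δ : ℝ} (hδ : 0 < δ)
    {t : CStarMatrix (Fin n) (Fin n) (CrossedProduct G X)}
    (ht : IsRNormalizer (diagSubalgebra G X n) t) :
    ∃ t', IsRNormalizer (diagSubalgebra G X n) t' ∧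
      star t' * diag G X n b * t' = star t * cutDown (diag G X n b) δ * t := by
  -- The maximum in the denominator equals `re (b i x)` where the numerator is nonzero.
  let c : Fin n → C(X, ℂ) := fun i =>
    ⟨fun x => (√(max ((b i x).re - δ) 0 / max (b i x).re δ) : ℝ), by
      refine Complex.continuous_ofReal.comp (Real.continuous_sqrt.comp ?_)
      refine Continuous.div (by fun_prop) (by fun_prop) fun x => ?_
      exact (lt_max_of_lt_right hδ).ne'⟩
  have hc : star c = c := by
    ext i x
    exact Complex.conj_ofReal _
  have hcb : c * b * c = fun i => cutFun (b i) δ := by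
    ext i x
    change ((√(max ((b i x).re - δ) 0 / max (b i x).re δ) : ℝ) : ℂ) * b i x *
      (√(max ((b i x).re - δ) 0 / max (b i x).re δ) : ℝ) = (max ((b i x).re - δ) 0 : ℝ)
    rw [← ofReal_re_of_nonneg (hb i) x, Complex.ofReal_re, ← Complex.ofReal_mul,
      ← Complex.ofReal_mul, mul_right_comm, Real.mul_self_sqrt (by positivity)]
    rcases le_total (b i x).re δ with h | h
    · simp [max_eq_right (sub_nonpos.2 h)]
    · have : (b i x).re ≠ 0 := (hδ.trans_le h).ne'
      rw [max_eq_left h, div_mul_cancel₀ _ this]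
  refine ⟨diag G X n c * t, fun d hd => ?_, ?_⟩
  · have := ht (diag G X n c * d * diag G X n c)
      (mul_mem (mul_mem ⟨c, rfl⟩ hd) ⟨c, rfl⟩)
    rw [star_mul, ← map_star, hc]
    simpa only [mul_assoc] using this
  · rw [cutDown_diag hb, ← hcb, star_mul, ← map_star, hc, map_mul, map_mul]
    simp only [mul_assoc]

theorem exists_tendsto_of_forall_cutDown {n : ℕ} {a b : Fin n → C(X, ℂ)}
    (ha : ∀ i, 0 ≤ a i) (hb : ∀ i, 0 ≤ b i)
    (h : ∀ ε : ℝ, 0 < ε → ∃ δ : ℝ, 0 < δ ∧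
        ∃ t : CStarMatrix (Fin n) (Fin n) (CrossedProduct G X),
          IsRNormalizer (diagSubalgebra G X n) t ∧
          star t * cutDown (diag G X n b) δ * t = cutDown (diag G X n a) ε) :
    ∃ t : ℕ → CStarMatrix (Fin n) (Fin n) (CrossedProduct G X),
      (∀ k, IsRNormalizer (diagSubalgebra G X n) (t k)) ∧
      Filter.Tendsto (fun k => ‖star (t k) * diag G X n b * t k - diag G X n a‖)
        Filter.atTop (𝓝 0) := by
  have key : ∀ k : ℕ, ∃ t : CStarMatrix (Fin n) (Fin n) (CrossedProduct G X),
      IsRNormalizer (diagSubalgebra G X n) t ∧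
      ‖star t * diag G X n b * t - diag G X n a‖ ≤ 1 / ((k : ℝ) + 1) := by
    intro k
    have hε : 0 < 1 / ((k : ℝ) + 1) := Nat.one_div_pos_of_nat
    obtain ⟨δ, hδ, t, ht, hta⟩ := h _ hε
    obtain ⟨t', ht', htt'⟩ := exists_isRNormalizer_star_mul_diag_mul hb hδ ht
    refine ⟨t', ht', ?_⟩
    rw [htt', hta, cutDown_diag ha, ← map_sub]
    refine (NonUnitalStarAlgHom.norm_apply_le (diag G X n) _).trans ?_
    exact (pi_norm_le_iff_of_nonneg hε.le).2 fun i => norm_cutFun_sub_le (ha i) hε.le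
  choose t ht hta using key
  exact ⟨t, ht, squeeze_zero (fun _ => norm_nonneg _) hta tendsto_one_div_add_atTop_nhds_zero_nat⟩

end CutDown

/-! ### From dynamical subequivalence to exact conjugation -/

section Translation

variable {G X : Type*} [Group G] [TopologicalSpace X] [CompactSpace X] [MulAction G X]

variable (X) in
/-- The canonical unitary `u_g` as an element of `C(X) ⋊ G`. -/
def unitaryElt (g : G) : CrossedProduct G X :=
  ⟨shiftOp X g, StarSubalgebra.le_topologicalClosure _
    (StarAlgebra.subset_adjoin ℂ _ (Or.inr ⟨g, rfl⟩))⟩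

@[simp]
theorem toOp_unitaryElt (g : G) : toOp G X (unitaryElt X g) = shiftOp X g := rfl

theorem toOp_star_unitaryElt_mul_incl_mul_apply (s s' : G) (f d f' : C(X, ℂ)) (ξ : RegSpace G X)
    (p : G × X) :
    toOp G X (star (unitaryElt X s * incl G X f) * incl G X d *
      (unitaryElt X s' * incl G X f')) ξ p =
      star (f (p.1 • p.2)) * (d (s • p.1 • p.2) *
        (f' (s'⁻¹ • s • p.1 • p.2) * ξ (s'⁻¹ * (s * p.1), p.2))) := by
  rw [map_mul, map_mul, map_star, map_mul, map_mul, star_mul, toOp_unitaryElt, toOp_unitaryElt,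
    star_shiftOp, toOp_incl, toOp_incl, toOp_incl, ← star_multOp]
  simp [multOp_apply, shiftOp_apply, mul_smul]

theorem star_unitaryElt_mul_incl_mul_eq_zero {s s' : G} {f f' : C(X, ℂ)}
    (h : ∀ x x', s • x = s' • x' → f x = 0 ∨ f' x' = 0) (d : C(X, ℂ)) :
    star (unitaryElt X s * incl G X f) * incl G X d * (unitaryElt X s' * incl G X f') = 0 := by
  refine toOp_injective (ContinuousLinearMap.ext fun ξ => lp.ext (funext fun p => ?_))
  rw [toOp_star_unitaryElt_mul_incl_mul_apply]
  rcases h (p.1 • p.2) (s'⁻¹ • s • p.1 • p.2) (smul_inv_smul _ _).symm with h | h <;> simp [h]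

/-- The matrix `∑ e_{k(i,j), i} ⊗ u_{s(i,j)} γ(i,j)`, the sum being over all pairs `(i, j)`. -/
def translationMatrix {n : ℕ} {J : Fin n → ℕ} (s : (i : Fin n) → Fin (J i) → G)
    (k : (i : Fin n) → Fin (J i) → Fin n) (γ : (i : Fin n) → Fin (J i) → C(X, ℂ)) :
    CStarMatrix (Fin n) (Fin n) (CrossedProduct G X) :=
  CStarMatrix.ofMatrix <| Matrix.of fun l i =>
    ∑ j, if k i j = l then unitaryElt X (s i j) * incl G X (γ i j) else 0

theorem translationMatrix_apply {n : ℕ} {J : Fin n → ℕ} (s : (i : Fin n) → Fin (J i) → G)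
    (k : (i : Fin n) → Fin (J i) → Fin n) (γ : (i : Fin n) → Fin (J i) → C(X, ℂ)) (l i : Fin n) :
    translationMatrix s k γ l i =
      ∑ j, if k i j = l then unitaryElt X (s i j) * incl G X (γ i j) else 0 := rfl

variable [ContinuousConstSMul G X]

/-- The function `x ↦ d (s • x)`. -/
def translate (s : G) (d : C(X, ℂ)) : C(X, ℂ) := ⟨fun x => d (s • x), by fun_prop⟩

theorem star_unitaryElt_mul_incl_mul_self (s : G) (f d : C(X, ℂ)) :
    star (unitaryElt X s * incl G X f) * incl G X d * (unitaryElt X s * incl G X f) =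
      incl G X (star f * translate s d * f) := by
  refine toOp_injective (ContinuousLinearMap.ext fun ξ => lp.ext (funext fun p => ?_))
  rw [toOp_star_unitaryElt_mul_incl_mul_apply, toOp_incl, multOp_apply]
  simp [translate, mul_assoc]

/-- The disjointness of the translated supports removes all mixed terms. -/
theorem star_translationMatrix_mul_diag_mul {n : ℕ} {J : Fin n → ℕ}
    {s : (i : Fin n) → Fin (J i) → G} {k : (i : Fin n) → Fin (J i) → Fin n}
    {γ : (i : Fin n) → Fin (J i) → C(X, ℂ)}
    (hdisj : ∀ p q : (Σ i, Fin (J i)), p ≠ q → k p.1 p.2 = k q.1 q.2 →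
      ∀ x x', s p.1 p.2 • x = s q.1 q.2 • x' → γ p.1 p.2 x = 0 ∨ γ q.1 q.2 x' = 0)
    (d : Fin n → C(X, ℂ)) :
    star (translationMatrix s k γ) * diag G X n d * translationMatrix s k γ =
      diag G X n fun i => ∑ j, star (γ i j) * translate (s i j) (d (k i j)) * γ i j := by
  ext i i'
  have hterm : ∀ l j j', (⟨i, j⟩ : Σ i, Fin (J i)) ≠ ⟨i', j'⟩ →
      star (if k i j = l then unitaryElt X (s i j) * incl G X (γ i j) else 0) * incl G X (d l) *
        (if k i' j' = l then unitaryElt X (s i' j') * incl G X (γ i' j') else 0) = 0 := by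
    intro l j j' hne
    split_ifs with h h'
    · exact star_unitaryElt_mul_incl_mul_eq_zero (hdisj ⟨i, j⟩ ⟨i', j'⟩ hne (h.trans h'.symm)) _
    all_goals simp
  rw [star_mul_diag_mul_apply, diag_apply]
  simp only [translationMatrix_apply, star_sum, Finset.sum_mul, Finset.mul_sum]
  split_ifs with hi
  · subst hi
    rw [map_sum, Finset.sum_comm]
    refine Finset.sum_congr rfl fun j _ => ?_
    rw [Finset.sum_eq_single (k i j), Finset.sum_eq_single j]
    · simpa using star_unitaryElt_mul_incl_mul_self (s i j) (γ i j) (d (k i j))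
    · exact fun j' _ hj' => hterm _ _ _ fun h => hj' (by simpa [eq_comm] using h)
    · simp
    · exact fun l _ hl => Finset.sum_eq_zero fun j' _ => by simp [hl.symm]
    · simp
  · refine Finset.sum_eq_zero fun l _ => Finset.sum_eq_zero fun j _ =>
      Finset.sum_eq_zero fun j' _ => hterm l _ _ fun h => hi (congrArg Sigma.fst h)

/-- The `r`-normalizer is `∑ e_{k(i,j), i} ⊗ u_{s(i,j)} γ(i,j)`, where `γ(i,j)` is obtained from a
partition of unity on the compact sets `{a_i ≥ ε}`. -/
theorem exists_cutDown_of_dynSubequiv [T2Space X] {n : ℕ} {a b : Fin n → C(X, ℂ)}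
    (ha : ∀ i, 0 ≤ a i) (hb : ∀ i, 0 ≤ b i) (hab : DynSubequiv G a b) {ε : ℝ} (hε : 0 < ε) :
    ∃ δ : ℝ, 0 < δ ∧
      ∃ t : CStarMatrix (Fin n) (Fin n) (CrossedProduct G X),
        IsRNormalizer (diagSubalgebra G X n) t ∧
        star t * cutDown (diag G X n b) δ * t = cutDown (diag G X n a) ε := by
  have hF : ∀ i, IsClosed {x | ε ≤ (a i x).re} := fun i =>
    isClosed_le continuous_const (Complex.continuous_re.comp (a i).continuous)
  obtain ⟨J, U, s, k, hU, hcov, hdisj, hV⟩ := hab (fun i => {x | ε ≤ (a i x).re})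
    (fun i => (hF i).isCompact) fun i x hx h0 => by
      have : ε ≤ (a i x).re := hx
      rw [h0, Complex.zero_re] at this
      exact hε.not_ge this
  choose h hh using fun i => PartitionOfUnity.exists_isSubordinate (hF i) (U i) (hU i) (hcov i)
  have hδ : ∀ p : (Σ i, Fin (J i)), ∀ᶠ δ in 𝓝[>] (0 : ℝ), ∀ x ∈ tsupport (h p.1 p.2),
      2 * δ ≤ (b (k p.1 p.2) (s p.1 p.2 • x)).re := by
    intro p
    obtain ⟨c, hc, hlt⟩ := exists_pos_forall_lt_of_isCompact
      (isClosed_tsupport (h p.1 p.2)).isCompact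
      (f := fun x => (b (k p.1 p.2) (s p.1 p.2 • x)).re)
      (by fun_prop) fun x hx => by
        have hx' := hV p.1 p.2 (a := (s p.1 p.2 • x, k p.1 p.2)) ⟨⟨x, hh p.1 p.2 hx, rfl⟩, rfl⟩
        obtain ⟨l, hl⟩ := Set.mem_iUnion.1 hx'
        obtain ⟨hbx, rfl⟩ : _ ∧ k p.1 p.2 = l := hl
        refine (re_nonneg_of_nonneg (hb _) _).lt_of_ne fun h0 => hbx ?_
        change b (k p.1 p.2) (s p.1 p.2 • x) = 0
        rw [← ofReal_re_of_nonneg (hb _), ← h0, Complex.ofReal_zero]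
    filter_upwards [Ioo_mem_nhdsGT (half_pos hc)] with δ hδ x hx
    linarith [hlt x hx, hδ.2]
  obtain ⟨δ, hδb, hδ : 0 < δ⟩ :=
    ((Filter.eventually_all.2 hδ).and self_mem_nhdsWithin).exists
  -- The maximum in the denominator equals `(b - δ)₊` at `s • x` where `h` is nonzero.
  let γ : (i : Fin n) → Fin (J i) → C(X, ℂ) := fun i j =>
    ⟨fun x => (√(h i j x * max ((a i x).re - ε) 0 /
      max ((b (k i j) (s i j • x)).re - δ) δ) : ℝ), by
      refine Complex.continuous_ofReal.comp (Real.continuous_sqrt.comp ?_)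
      refine Continuous.div (by fun_prop) (by fun_prop) fun x => ?_
      exact (lt_max_of_lt_right hδ).ne'⟩
  have hγU : ∀ i j x, γ i j x ≠ 0 → x ∈ U i j := by
    intro i j x hx
    refine hh i j (subset_tsupport _ fun h0 => hx ?_)
    simp [γ, h0]
  have key := star_translationMatrix_mul_diag_mul (s := s) (k := k) (γ := γ)
    fun p q hpq hk x x' hs => by
    by_contra! hne
    refine Set.disjoint_left.1 (hdisj hpq) (show (s p.1 p.2 • x, k p.1 p.2) ∈ _ from ?_) ?_
    · exact ⟨⟨x, hγU _ _ _ hne.1, rfl⟩, rfl⟩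
    · exact ⟨⟨x', hγU _ _ _ hne.2, hs.symm⟩, hk⟩
  refine ⟨δ, hδ, translationMatrix s k γ, ?_, ?_⟩
  · rintro _ ⟨d, rfl⟩
    exact ⟨_, (key d).symm⟩
  · rw [cutDown_diag ha, cutDown_diag hb, key]
    congr 1
    ext i x
    have hj : ∀ j, (star (γ i j) * translate (s i j) (cutFun (b (k i j)) δ) * γ i j) x =
        (h i j x * max ((a i x).re - ε) 0 : ℝ) := by
      intro j
      change star ((√(h i j x * max ((a i x).re - ε) 0 /
        max ((b (k i j) (s i j • x)).re - δ) δ) : ℝ) : ℂ) *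
        (max ((b (k i j) (s i j • x)).re - δ) 0 : ℝ) *
        (√(h i j x * max ((a i x).re - ε) 0 /
          max ((b (k i j) (s i j • x)).re - δ) δ) : ℝ) = _
      have h0 := (h i).nonneg j x
      rw [show star ((√(h i j x * max ((a i x).re - ε) 0 /
        max ((b (k i j) (s i j • x)).re - δ) δ) : ℝ) : ℂ) = _ from Complex.conj_ofReal _,
        ← Complex.ofReal_mul, ← Complex.ofReal_mul, mul_right_comm,
        Real.mul_self_sqrt (by positivity)]
      by_cases hx : h i j x = 0
      · simp [hx]
      · have := hδb ⟨i, j⟩ x (subset_tsupport _ hx)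
        simp only at this
        rw [max_eq_left (by linarith : δ ≤ _), max_eq_left (by linarith : (0 : ℝ) ≤ _ - δ),
          div_mul_cancel₀]
        linarith
    rw [ContinuousMap.sum_apply, Finset.sum_congr rfl fun j _ => hj j, ← Complex.ofReal_sum,
      ← Finset.sum_mul, cutFun_apply]
    congr 1
    by_cases hx : ε ≤ (a i x).re
    · rw [← finsum_eq_sum_of_fintype, (h i).sum_eq_one hx, one_mul]
    · rw [max_eq_right (by linarith), mul_zero]

end Translation

end DynCuntz

end

theorem mainTheorem3 {G X : Type*} [Group G] [Countable G] [TopologicalSpace X] [CompactSpace X]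
    [T2Space X] [MulAction G X] [ContinuousConstSMul G X]
    (hfree : ∀ (g : G) (x : X), g • x = x → g = 1)
    (n : ℕ) (a b : Fin n → C(X, ℂ)) (ha : ∀ i, 0 ≤ a i) (hb : ∀ i, 0 ≤ b i) :
    List.TFAE [
      DynCuntz.DynSubequiv G a b,
      ∃ t : ℕ → CStarMatrix (Fin n) (Fin n) (DynCuntz.CrossedProduct G X),
        (∀ k, DynCuntz.IsRNormalizer (DynCuntz.diagSubalgebra G X n) (t k)) ∧
        Filter.Tendsto
          (fun k => ‖star (t k) * DynCuntz.diag G X n b * t k - DynCuntz.diag G X n a‖)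
          Filter.atTop (𝓝 0),
      ∀ ε : ℝ, 0 < ε → ∃ δ : ℝ, 0 < δ ∧
        ∃ t : CStarMatrix (Fin n) (Fin n) (DynCuntz.CrossedProduct G X),
          DynCuntz.IsRNormalizer (DynCuntz.diagSubalgebra G X n) t ∧
          star t * DynCuntz.cutDown (DynCuntz.diag G X n b) δ * t =
            DynCuntz.cutDown (DynCuntz.diag G X n a) ε] := by
  tfae_have 1 → 3 := fun h ε hε => DynCuntz.exists_cutDown_of_dynSubequiv ha hb h hε
  tfae_have 3 → 2 := DynCuntz.exists_tendsto_of_forall_cutDown ha hb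
  tfae_have 2 → 1 := fun ⟨_, ht, hlim⟩ => DynCuntz.dynSubequiv_of_tendsto hfree ht hlim
  tfae_finish
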